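/- Let $\chi(n)$ be the primitive character of conductor $12$, i.e. $\chi(n)=1$ if $n\equiv 1,11$, $\chi(n)=-1$ if $n\equiv 5,7$ modulo $12$, and $\chi(n)=0$ otherwise. Let $\mathcal N=\{n^2\pi^2/6 : n\in\mathbb N,\ \chi(n)\neq 0\}$ and let $G$ be the multivalued analytic function on $\mathbb C\setminus\mathcal N$ whose germ at $p=0$ is $$G(p)=\frac{3\pi}{2\sqrt2}\sum_{n=1}^\infty\frac{\chi(n)\,n}{(-p+n^2\pi^2/6)^{5/2}}$$ (principal powers near $p=0$). For $\Re(x)>0$ let $$S^{\mathbf{med}}(x)=\frac12\left(\int_{\gamma_r}e^{-px}G(p)\,dp+\int_{\gamma_l}e^{-px}G(p)\,dp\right)$$ be the median Laplace transform of $G$. Here $\gamma_l$ (resp. $\gamma_r$) is any path from $0$ to $\infty$ that turns left (resp. right) at each point of $\mathcal N$, and $G$ is continued analytically along it. Precisely, $\gamma:[0,\infty)\to\mathbb C$ is continuous with $\gamma(0)=0$, is differentiable off a countable set with bounded derivative, stays in the closed upper (resp. lower) half-plane at a positive distance from $\mathcal N$, and satisfies $\gamma(t)/t\to1$ as $t\to\infty$.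 Put $$\mathrm{Erfi}(x)=\frac{2}{\sqrt\pi}\int_0^x e^{t^2}\,dt,\qquad \mathcal E(x)=e^{-x^2}x^3\,\mathrm{Erfi}(x)-\frac{x^2}{\sqrt\pi}.$$ Then for every $x$ with $\Re(x)>0$ both integrals converge absolutely for all such paths, the series below converges absolutely, and $$S^{\mathbf{med}}(x)=\frac{12\sqrt3}{\pi^{3/2}}\sum_{n=1}^\infty\frac{\chi(n)}{n^2}\,\mathcal E\!\left(n\pi\sqrt{\frac x6}\right)-1 ,$$ with the principal square root. Moreover, the series converges locally uniformly on the open right half-plane $\Re(x)>0$, and uniformly on each sector $\{x\neq0 : |\arg x|\le\theta\}$ with $\theta<\pi/2$. -/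

import Mathlib

open Filter Topology Set MeasureTheory

noncomputable section

/-- The primitive character of conductor 12: `1` at `n ≡ 1, 11`, `-1` at `n ≡ 5, 7` modulo 12,
and `0` otherwise. In particular it vanishes at `0`. -/
def chi12 (n : ℕ) : ℂ :=
  if n % 12 = 1 ∨ n % 12 = 11 then 1
  else if n % 12 = 5 ∨ n % 12 = 7 then -1
  else 0

/-- The singularities `n² π² / 6`, with `n ≡ 1, 5, 7, 11` modulo 12, as complex numbers. -/
def singularSet : Set ℂ :=
  {η | ∃ n : ℕ, (n % 12 = 1 ∨ n % 12 = 5 ∨ n % 12 = 7 ∨ n % 12 = 11) ∧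
    η = (n : ℂ) ^ 2 * (Real.pi : ℂ) ^ 2 / 6}

/-- The series `G(p) = 3π/(2√2) ∑ χ(n) n / (-p + n² π² / 6)^(5/2)`, with principal powers (the term
`n = 0` is zero). Only its values near `p = 0`, where `n² π² / 6 - p` has positive real part for
`n ≥ 1`, are used below: the values elsewhere come from analytic continuation along paths. -/
def borelG (p : ℂ) : ℂ :=
  3 * (Real.pi : ℂ) / (2 * (Real.sqrt 2 : ℂ)) *
    ∑' n : ℕ, chi12 n * n / (-p + (n : ℂ) ^ 2 * (Real.pi : ℂ) ^ 2 / 6) ^ (5 / 2 : ℂ)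

/-- A path `γ : [0, ∞) → ℂ ∖ N` from `0` to infinity in the direction of the positive real axis.
It is continuous, differentiable off a countable set of parameters with bounded derivative (so
piecewise smooth paths, with corners, are included), stays at a positive distance from `N`, and is
parametrized so that `γ(t) ~ t` as `t → ∞`. -/
structure IsLaplacePath (N : Set ℂ) (γ : ℝ → ℂ) : Prop where
  start : γ 0 = 0
  continuousOn : ContinuousOn γ (Ici 0)
  differentiable : ∃ S : Set ℝ, S.Countable ∧ ∀ t, 0 < t → t ∉ S → DifferentiableAt ℝ γ t
  deriv_bounded : ∃ C : ℝ, ∀ t, 0 < t → ‖deriv γ t‖ ≤ C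
  avoids : ∃ δ : ℝ, 0 < δ ∧ ∀ t, 0 ≤ t → ∀ η ∈ N, δ ≤ ‖γ t - η‖
  to_infinity : Tendsto (fun t : ℝ => γ t / (t : ℂ)) atTop (𝓝 1)

/-- A path that turns left at each point of `N ⊆ (0, ∞)`: it goes from `0` to infinity in the
closed upper half-plane, avoiding `N`. -/
def IsLeftPath (N : Set ℂ) (γ : ℝ → ℂ) : Prop :=
  IsLaplacePath N γ ∧ ∀ t, 0 ≤ t → 0 ≤ (γ t).im

/-- A path that turns right at each point of `N ⊆ (0, ∞)`: it goes from `0` to infinity in the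
closed lower half-plane, avoiding `N`. -/
def IsRightPath (N : Set ℂ) (γ : ℝ → ℂ) : Prop :=
  IsLaplacePath N γ ∧ ∀ t, 0 ≤ t → (γ t).im ≤ 0

/-- `g t` is the value at `γ t` of the analytic continuation along the path `γ : [0, ∞) → ℂ` of the
germ of `G` at `γ 0`. Here `Φ t` represents the continued germ at `γ t`. -/
def IsContinuationAlong (G : ℂ → ℂ) (γ : ℝ → ℂ) (g : ℝ → ℂ) : Prop :=
  ∃ Φ : ℝ → ℂ → ℂ,
    Φ 0 =ᶠ[𝓝 (γ 0)] G ∧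
    (∀ t, 0 ≤ t → AnalyticAt ℂ (Φ t) (γ t)) ∧
    (∀ t, 0 ≤ t → ∀ᶠ s in 𝓝[Ici 0] t, Φ s =ᶠ[𝓝 (γ s)] Φ t) ∧
    ∀ t, 0 ≤ t → g t = Φ t (γ t)

/-- The germ of `G` at `γ 0` continues analytically along `γ`, the integral `∫_γ e^{-xp} G(p) dp` of
its continuation converges absolutely, and its value is `L`. -/
def HasLaplaceAlong (G : ℂ → ℂ) (γ : ℝ → ℂ) (x L : ℂ) : Prop :=
  ∃ g : ℝ → ℂ, IsContinuationAlong G γ g ∧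
    IntegrableOn (fun t => Complex.exp (-(x * γ t)) * g t * deriv γ t) (Ioi 0) ∧
    ∫ t in Ioi (0 : ℝ), Complex.exp (-(x * γ t)) * g t * deriv γ t = L

/-- The median Laplace transform at `x` of the multivalued function on `ℂ ∖ N` with germ `G` at `0`
exists and equals `L`: the Laplace integrals of `G` along all paths that turn right, respectively
left, at each point of `N` exist, and the average of the two lateral integrals is `L`. -/
def HasMedianLaplace (N : Set ℂ) (G : ℂ → ℂ) (x L : ℂ) : Prop :=
  ∀ γr γl : ℝ → ℂ, IsRightPath N γr → IsLeftPath N γl →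
    ∃ Lr Ll : ℂ, HasLaplaceAlong G γr x Lr ∧ HasLaplaceAlong G γl x Ll ∧ (Lr + Ll) / 2 = L

/-- `Erfi(x) = (2/√π) ∫_0^x e^{t²} dt`, integrated along the segment from `0` to `x`. -/
def erfi (x : ℂ) : ℂ :=
  2 / (Real.sqrt Real.pi : ℂ) * ∫ s in (0 : ℝ)..1, Complex.exp (((s : ℂ) * x) ^ 2) * x

/-- `𝓔(x) = e^{-x²} x³ Erfi(x) - x²/√π`. -/
def modErfi (x : ℂ) : ℂ :=
  Complex.exp (-x ^ 2) * x ^ 3 * erfi x - x ^ 2 / (Real.sqrt Real.pi : ℂ)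

/-- The term `χ(n)/n² · 𝓔(nπ√(x/6))`, with the principal square root. It is zero for `n = 0`. -/
def lapTerm (n : ℕ) (x : ℂ) : ℂ :=
  chi12 n / (n : ℂ) ^ 2 * modErfi (n * (Real.pi : ℂ) * (x / 6) ^ (1 / 2 : ℂ))

/-- Paths in the upper half-plane, and in the lower one, of the above kind exist. -/
theorem isLaplacePath_arctan (s : ℝ) (hs : |s| = 1) :
    IsLaplacePath singularSet (fun t : ℝ => (t : ℂ) + (s : ℂ) * Complex.I * (Real.arctan t : ℂ)) := by
  have hd : ∀ t : ℝ, HasDerivAt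
      (fun t : ℝ => (t : ℂ) + (s : ℂ) * Complex.I * (Real.arctan t : ℂ))
      (1 + (s : ℂ) * Complex.I * ((1 / (1 + t ^ 2) : ℝ) : ℂ)) t := fun t =>
    ((hasDerivAt_id t).ofReal_comp).add (((Real.hasDerivAt_arctan t).ofReal_comp).const_mul _)
  have hsI : ‖(s : ℂ) * Complex.I‖ = 1 := by simp [hs]
  refine ⟨by simp, fun t _ => (hd t).continuousAt.continuousWithinAt,
    ⟨∅, countable_empty, fun t _ _ => (hd t).differentiableAt⟩, ⟨2, fun t _ => ?_⟩,
    ⟨1 / 2, by norm_num, fun t ht η hη => ?_⟩, ?_⟩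
  · rw [(hd t).deriv]
    refine (norm_add_le _ _).trans ?_
    rw [norm_mul, hsI, Complex.norm_real, Real.norm_of_nonneg (by positivity)]
    have : 1 / (1 + t ^ 2) ≤ 1 := by
      rw [div_le_one (by positivity)]; nlinarith [sq_nonneg t]
    simp only [norm_one, one_mul]; linarith
  · obtain ⟨n, hn, rfl⟩ := hη
    have hn1 : (1 : ℝ) ≤ n := by exact_mod_cast (by omega : 1 ≤ n)
    have hre : ((t : ℂ) + (s : ℂ) * Complex.I * (Real.arctan t : ℂ)
        - (n : ℂ) ^ 2 * (Real.pi : ℂ) ^ 2 / 6) =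
        ((t - (n : ℝ) ^ 2 * Real.pi ^ 2 / 6 : ℝ) : ℂ) + ((s * Real.arctan t : ℝ) : ℂ) * Complex.I := by
      push_cast; ring
    rw [hre]
    rcases le_total t 1 with h | h
    · refine le_trans ?_ (Complex.abs_re_le_norm _)
      have h3 := Real.pi_gt_three
      have : (9 : ℝ) ≤ (n : ℝ) ^ 2 * Real.pi ^ 2 := by
        have h6 : (1 : ℝ) ≤ (n : ℝ) ^ 2 := by nlinarith
        have h7 : (9 : ℝ) ≤ Real.pi ^ 2 := by nlinarith
        nlinarith
      have h4 : t - (n : ℝ) ^ 2 * Real.pi ^ 2 / 6 ≤ -(1 / 2) := by linarith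
      have h5 := neg_le_abs (t - (n : ℝ) ^ 2 * Real.pi ^ 2 / 6)
      rw [Complex.add_re, Complex.re_ofReal_mul, Complex.I_re, Complex.ofReal_re, mul_zero, add_zero]
      linarith
    · refine le_trans ?_ (Complex.abs_im_le_norm _)
      rw [Complex.add_im, Complex.im_ofReal_mul, Complex.I_im, Complex.ofReal_im, mul_one, zero_add,
        abs_mul, hs, one_mul]
      have h1 : Real.arctan 1 ≤ Real.arctan t := Real.arctan_strictMono.monotone h
      rw [Real.arctan_one] at h1
      have := Real.pi_gt_three
      exact le_trans (by linarith) (le_abs_self _)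
  · have h0 : Tendsto (fun t : ℝ => (s : ℂ) * Complex.I * (Real.arctan t : ℂ) / (t : ℂ)) atTop
        (𝓝 0) := by
      refine squeeze_zero_norm' (a := fun t : ℝ => Real.pi / 2 / t) ?_
        (tendsto_const_nhds.div_atTop tendsto_id)
      filter_upwards [eventually_gt_atTop 0] with t ht
      rw [norm_div, norm_mul, hsI, one_mul, Complex.norm_real, Complex.norm_real,
        Real.norm_of_nonneg ht.le]
      gcongr
      exact abs_le.2 ⟨(Real.neg_pi_div_two_lt_arctan t).le, (Real.arctan_lt_pi_div_two t).le⟩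
    have h1 := h0.const_add 1
    rw [add_zero] at h1
    refine h1.congr' ?_
    filter_upwards [eventually_gt_atTop 0] with t ht
    have : (t : ℂ) ≠ 0 := by exact_mod_cast ht.ne'
    field_simp

theorem exists_isLeftPath : ∃ γ, IsLeftPath singularSet γ :=
  ⟨_, isLaplacePath_arctan 1 (by simp), fun t ht => by
    have := Real.arctan_nonneg.2 ht
    simpa [-Complex.ofReal_arctan, Complex.mul_im] using this⟩

theorem exists_isRightPath : ∃ γ, IsRightPath singularSet γ :=
  ⟨_, isLaplacePath_arctan (-1) (by simp), fun t ht => by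
    have := Real.arctan_nonneg.2 ht
    simpa [-Complex.ofReal_arctan, Complex.mul_im] using this⟩

end

/-! ### The integral along a segment and the imaginary error function -/

/-! The Laplace integral is computed term by term. Put `η = n²π²/6`, `x = r²` and `u = √(η - p)`, on
the branch obtained by following the path. Then `e^{-xp} (η - p)^{-5/2} dp = -2 e^{-xη} e^{u²r²} u⁻⁴
du`, which has the primitive `expPrimitive`, made of elementary terms and `erfi (u r)`. Beyond all
the singularities `u` behaves like `-ε√t`, with `ε = I` for left paths and `ε = -I` for right ones.
The elementary terms therefore die and `erfi (u r)` tends to `-ε` (`tendsto_erfi_lateralSqrt`, a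
rotated Gaussian integral). Each term of a lateral integral is thus its endpoint value at `u = √η`
plus a constant times `ε` (`integral_lateral`).

Averaging over `ε = ±I` cancels that constant. What remains of the `n`th term is a multiple of
`lapTerm n x` minus `(6√3/π²) χ(n)/n²` (`lateralValue_average`). The second part sums to `1` because
`L(2, χ) = π²/(6√3)` (`hasSum_chi12_div_sq`).

Exchanging sum and integral rests on `|η - p| ≥ b n²` at positive distance from the singularities
(`norm_lateralTerm_le`). The same bound shows that the series on the lateral branches is analytic,
so that a single function continues the germ along the whole path. Convergence of the final series
comes from `norm_modErfi_le`: its terms are `O(n⁻²)`, with a constant depending only on `‖x‖ / Re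
x`. -/

theorem integral_segment_eq_sub {f F : ℂ → ℂ} (hF : ∀ z, HasDerivAt F (f z) z)
    (hf : Continuous f) (z : ℂ) :
    ∫ s in (0 : ℝ)..1, f ((s : ℂ) * z) * z = F z - F 0 := by
  have hd : ∀ s : ℝ, HasDerivAt (fun s : ℝ => F ((s : ℂ) * z)) (f ((s : ℂ) * z) * z) s := fun s => by
    have h1 : HasDerivAt (fun s : ℝ => (s : ℂ) * z) z s := by
      simpa using (HasDerivAt.ofReal_comp (hasDerivAt_id s)).mul_const z
    exact (hF ((s : ℂ) * z)).comp s h1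
  have hc : Continuous fun s : ℝ => f ((s : ℂ) * z) * z := by fun_prop
  simpa using intervalIntegral.integral_eq_sub_of_hasDerivAt (fun s _ => hd s)
    (hc.intervalIntegrable 0 1)

theorem exists_primitive {f : ℂ → ℂ} (hf : Differentiable ℂ f) :
    ∃ F : ℂ → ℂ, ∀ z, HasDerivAt F (f z) z := by
  obtain ⟨F, hF⟩ := hf.isExactOn_univ
  exact ⟨F, fun z => hF z (mem_univ z)⟩

theorem hasDerivAt_erfi (z : ℂ) :
    HasDerivAt erfi (2 / (Real.sqrt Real.pi : ℂ) * Complex.exp (z ^ 2)) z := by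
  obtain ⟨F, hF⟩ := exists_primitive (f := fun z => Complex.exp (z ^ 2)) (by fun_prop)
  have h : erfi = fun z => 2 / (Real.sqrt Real.pi : ℂ) * (F z - F 0) := by
    ext w
    rw [← integral_segment_eq_sub hF (by fun_prop) w]
    rfl
  rw [h]
  exact ((hF z).sub_const _).const_mul _

/-- By Cauchy, the segment from `0` to `W` may be replaced by the real segment to `Re W` followed by
a vertical one. The first gives half the Gaussian integral; the second hypothesis kills the other.
-/
theorem tendsto_integral_segment_gaussian {ι : Type*} {l : Filter ι} [l.IsCountablyGenerated]
    {W : ι → ℂ}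
    (hre : Tendsto (fun i => (W i).re) l atTop)
    (him : Tendsto (fun i => ‖W i‖ * Real.exp (-(W i ^ 2).re)) l (𝓝 0)) :
    Tendsto (fun i => ∫ s in (0 : ℝ)..1, Complex.exp (-((s : ℂ) * W i) ^ 2) * W i) l
      (𝓝 ((Real.sqrt Real.pi / 2 : ℝ) : ℂ)) := by
  obtain ⟨F, hF⟩ := exists_primitive (f := fun z => Complex.exp (-z ^ 2)) (by fun_prop)
  have h1 : ∀ a : ℝ, ∫ t in (0 : ℝ)..a, Complex.exp (-(t : ℂ) ^ 2) = F a - F 0 := fun a => by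
    have hc : Continuous fun t : ℝ => Complex.exp (-(t : ℂ) ^ 2) := by fun_prop
    simpa using intervalIntegral.integral_eq_sub_of_hasDerivAt
      (fun t _ => (hF (t : ℂ)).comp_ofReal) (hc.intervalIntegrable 0 a)
  have h2 : Tendsto (fun i => F (W i).re - F 0) l (𝓝 ((Real.sqrt Real.pi / 2 : ℝ) : ℂ)) := by
    have hi : IntegrableOn (fun t : ℝ => Complex.exp (-(t : ℂ) ^ 2)) (Ioi 0) := by
      have := (integrable_cexp_neg_mul_sq (b := 1) (by simp)).integrableOn (s := Ioi 0)
      simpa using this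
    have := intervalIntegral_tendsto_integral_Ioi 0 hi hre
    simp only [h1] at this
    have h3 : ∫ t in Ioi (0 : ℝ), Complex.exp (-(t : ℂ) ^ 2) =
        ((Real.sqrt Real.pi / 2 : ℝ) : ℂ) := by
      have h4 := integral_gaussian_Ioi 1
      rw [div_one] at h4
      rw [← h4, ← integral_complex_ofReal]
      simp
    rwa [h3] at this
  have h3 : Tendsto (fun i => F (W i) - F (W i).re) l (𝓝 0) := by
    refine squeeze_zero_norm (fun i => ?_) him
    set w := W i
    have hconv : Convex ℝ (segment ℝ (w.re : ℂ) w) := convex_segment _ _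
    -- Along the vertical segment `Re z` is fixed and `|Im z|` grows towards `w`, so `|exp (-z²)|`
    -- is largest at `w`.
    have hb : ∀ z ∈ segment ℝ (w.re : ℂ) w,
        ‖Complex.exp (-z ^ 2)‖ ≤ Real.exp (-(w ^ 2).re) := by
      rintro z ⟨a, b, ha, hb, hab, rfl⟩
      rw [Complex.norm_exp]
      refine Real.exp_le_exp.2 ?_
      have hre : (a • (w.re : ℂ) + b • w).re = w.re := by
        simp only [Complex.add_re, Complex.smul_re, Complex.ofReal_re, smul_eq_mul]
        rw [← add_mul, hab, one_mul]
      have him : (a • (w.re : ℂ) + b • w).im = b * w.im := by simp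
      simp only [pow_two, Complex.neg_re, Complex.mul_re, hre, him]
      have : b ^ 2 ≤ 1 := by nlinarith
      nlinarith [mul_le_mul_of_nonneg_right this (sq_nonneg w.im)]
    refine (hconv.norm_image_sub_le_of_norm_hasDerivWithin_le
      (fun z _ => (hF z).hasDerivWithinAt) hb (left_mem_segment ℝ _ _)
      (right_mem_segment ℝ _ _)).trans ?_
    rw [mul_comm]
    gcongr
    have : w - (w.re : ℂ) = (w.im : ℂ) * Complex.I := by
      linear_combination -(Complex.re_add_im w)
    rw [this, norm_mul, Complex.norm_I, mul_one, Complex.norm_real]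
    exact Complex.abs_im_le_norm w
  have h4 := h2.add h3
  rw [add_zero] at h4
  refine h4.congr fun i => ?_
  rw [integral_segment_eq_sub hF (by fun_prop)]
  ring

/-! ### Bounds for the series -/

theorem norm_chi12_le (n : ℕ) : ‖chi12 n‖ ≤ 1 := by
  unfold chi12
  split_ifs <;> simp

theorem integral_mul_exp_le {a : ℝ} (ha : 0 < a) :
    ∫ s in (0 : ℝ)..1, (1 - s) * Real.exp (-(a * (1 - s))) ≤ 1 / a ^ 2 := by
  have hd : ∀ s : ℝ, HasDerivAt (fun s : ℝ => ((1 - s) / a + 1 / a ^ 2) * Real.exp (-(a * (1 - s))))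
      ((1 - s) * Real.exp (-(a * (1 - s)))) s := fun s => by
    have h1 : HasDerivAt (fun s : ℝ => 1 - s) (-1) s := by
      simpa using (hasDerivAt_id s).const_sub 1
    have h2 := ((h1.div_const a).add_const (1 / a ^ 2)).mul ((h1.const_mul a).neg.exp)
    refine h2.congr_deriv ?_
    simp only [Pi.neg_apply]
    field_simp
    ring
  rw [intervalIntegral.integral_eq_sub_of_hasDerivAt (fun s _ => hd s)
    ((by fun_prop : Continuous _).intervalIntegrable 0 1)]
  have : 0 ≤ ((1 - 0) / a + 1 / a ^ 2) * Real.exp (-(a * (1 - 0))) := by positivity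
  simp only [sub_self, mul_zero, neg_zero, Real.exp_zero, zero_div, zero_add, mul_one]
  linarith

/-- Split `1 = (1 - s) + s` in `∫ exp (-z² (1 - s²)) ds`. The part with `s` integrates exactly and
cancels the term `-z²/√π`, leaving an expression that can be bounded by absolute values. -/
theorem modErfi_eq {z : ℂ} :
    modErfi z = 2 / (Real.sqrt Real.pi : ℂ) *
      ((z ^ 2) ^ 2 * ∫ s in (0 : ℝ)..1, (1 - (s : ℂ)) * Complex.exp (-(z ^ 2 * (1 - (s : ℂ) ^ 2))))
      - z ^ 2 * Complex.exp (-z ^ 2) / (Real.sqrt Real.pi : ℂ) := by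
  have h1 : ∫ s in (0 : ℝ)..1, z ^ 2 * (s : ℂ) * Complex.exp (-(z ^ 2 * (1 - (s : ℂ) ^ 2))) =
      1 / 2 - Complex.exp (-z ^ 2) / 2 := by
    have hd : ∀ s : ℝ, HasDerivAt (fun s : ℝ => Complex.exp (-(z ^ 2 * (1 - (s : ℂ) ^ 2))) / 2)
        (z ^ 2 * (s : ℂ) * Complex.exp (-(z ^ 2 * (1 - (s : ℂ) ^ 2)))) s := fun s => by
      have h2 : HasDerivAt (fun s : ℂ => Complex.exp (-(z ^ 2 * (1 - s ^ 2))) / 2)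
        (z ^ 2 * s * Complex.exp (-(z ^ 2 * (1 - s ^ 2)))) (s : ℂ) := by
        have := (((((hasDerivAt_id (s : ℂ)).pow 2).const_sub 1).const_mul (z ^ 2)).neg.cexp).div_const 2
        refine this.congr_deriv ?_
        simp
        ring
      exact h2.comp_ofReal
    rw [intervalIntegral.integral_eq_sub_of_hasDerivAt (fun s _ => hd s)
      ((by fun_prop : Continuous _).intervalIntegrable 0 1)]
    simp
  have h2 : Complex.exp (-z ^ 2) * ∫ s in (0 : ℝ)..1, Complex.exp (((s : ℂ) * z) ^ 2) * z =
      z * ∫ s in (0 : ℝ)..1, Complex.exp (-(z ^ 2 * (1 - (s : ℂ) ^ 2))) := by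
    rw [← intervalIntegral.integral_const_mul, ← intervalIntegral.integral_const_mul]
    congr 1
    ext s
    rw [← mul_assoc, ← Complex.exp_add, mul_comm]
    congr 2
    ring
  have h3 : z ^ 2 * ∫ s in (0 : ℝ)..1, (1 - (s : ℂ)) * Complex.exp (-(z ^ 2 * (1 - (s : ℂ) ^ 2))) =
      (z ^ 2 * ∫ s in (0 : ℝ)..1, Complex.exp (-(z ^ 2 * (1 - (s : ℂ) ^ 2)))) -
        (1 / 2 - Complex.exp (-z ^ 2) / 2) := by
    rw [← h1, ← intervalIntegral.integral_const_mul, ← intervalIntegral.integral_const_mul,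
      ← intervalIntegral.integral_sub ((by fun_prop : Continuous _).intervalIntegrable 0 1)
      ((by fun_prop : Continuous _).intervalIntegrable 0 1)]
    congr 1
    ext s
    ring
  unfold modErfi erfi
  linear_combination (2 / (Real.sqrt Real.pi : ℂ)) * z ^ 3 * h2 -
    (2 / (Real.sqrt Real.pi : ℂ)) * z ^ 2 * h3

/-- Since `1 - s² ≥ 1 - s` on `[0, 1]`, the integral in `modErfi_eq` is at most `1 / (Re z²)²`. With
`q = ‖z²‖ / Re z² ≥ 1`, the two summands contribute at most `2q²` and `q ≤ q²`. -/
theorem norm_modErfi_le {z : ℂ} (hz : 0 < (z ^ 2).re) :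
    ‖modErfi z‖ ≤ 3 * (‖z ^ 2‖ / (z ^ 2).re) ^ 2 := by
  rw [modErfi_eq]
  set X := z ^ 2
  have hpi : 1 ≤ Real.sqrt Real.pi := by
    rw [Real.one_le_sqrt]; linarith [Real.pi_gt_three]
  have hX : X.re ≤ ‖X‖ := Complex.re_le_norm X
  have hq : 1 ≤ ‖X‖ / X.re := by rwa [one_le_div hz]
  have h1 : ‖∫ s in (0 : ℝ)..1, (1 - (s : ℂ)) * Complex.exp (-(X * (1 - (s : ℂ) ^ 2)))‖ ≤
      1 / X.re ^ 2 := by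
    refine (intervalIntegral.norm_integral_le_of_norm_le zero_le_one
      (g := fun s => (1 - s) * Real.exp (-(X.re * (1 - s)))) (.of_forall fun s hs => ?_)
      ((by fun_prop : Continuous _).intervalIntegrable 0 1)).trans (integral_mul_exp_le hz)
    have hc : -(X * (1 - (s : ℂ) ^ 2)) = ((-(1 - s ^ 2) : ℝ) : ℂ) * X := by push_cast; ring
    have hs1 : (1 : ℂ) - s = ((1 - s : ℝ) : ℂ) := by push_cast; rfl
    rw [norm_mul, hc, Complex.norm_exp, Complex.re_ofReal_mul, hs1, Complex.norm_real,
      Real.norm_of_nonneg (by linarith [hs.2])]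
    have : 0 ≤ 1 - s := by linarith [hs.2]
    gcongr
    nlinarith [mul_nonneg hs.1.le this, mul_nonneg (mul_nonneg hs.1.le this) hz.le]
  have h2 : ‖X * Complex.exp (-X)‖ ≤ ‖X‖ / X.re := by
    rw [norm_mul, Complex.norm_exp, Complex.neg_re, div_eq_mul_inv]
    gcongr
    rw [Real.exp_neg]
    gcongr
    linarith [Real.add_one_le_exp X.re]
  have h3 : ‖(2 / (Real.sqrt Real.pi : ℂ))‖ ≤ 2 := by
    rw [norm_div, Complex.norm_real, Real.norm_of_nonneg (by positivity), Complex.norm_ofNat]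
    exact div_le_self (by norm_num) hpi
  refine (norm_sub_le _ _).trans ?_
  rw [norm_mul, norm_mul, norm_pow, norm_div (X * _), Complex.norm_real,
    Real.norm_of_nonneg (by positivity : 0 ≤ Real.sqrt Real.pi)]
  have h4 : ‖X * Complex.exp (-X)‖ / Real.sqrt Real.pi ≤ (‖X‖ / X.re) ^ 2 :=
    (div_le_self (norm_nonneg _) hpi).trans (h2.trans (by nlinarith))
  have h5 : ‖(2 / (Real.sqrt Real.pi : ℂ))‖ * (‖X‖ ^ 2 *
      ‖∫ s in (0 : ℝ)..1, (1 - (s : ℂ)) * Complex.exp (-(X * (1 - (s : ℂ) ^ 2)))‖) ≤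
      2 * (‖X‖ ^ 2 * (1 / X.re ^ 2)) := by gcongr
  have h6 : ‖X‖ ^ 2 * (1 / X.re ^ 2) = (‖X‖ / X.re) ^ 2 := by rw [div_pow]; ring
  rw [h6] at h5
  linarith

theorem cpow_half_sq (x : ℂ) : (x ^ (1 / 2 : ℂ)) ^ 2 = x := by
  have := Complex.cpow_nat_inv_pow x (n := 2) two_ne_zero
  rwa [Nat.cast_ofNat, ← one_div] at this

/-- The square of the argument of `modErfi` is a positive multiple of `x`, and `‖X‖ / Re X` is
invariant under positive scaling, so the bound on `modErfi` is uniform in `n`. -/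
theorem norm_lapTerm_le {x : ℂ} (hx : 0 < x.re) (n : ℕ) :
    ‖lapTerm n x‖ ≤ 3 * (‖x‖ / x.re) ^ 2 * (1 / (n : ℝ) ^ 2) := by
  rcases Nat.eq_zero_or_pos n with rfl | hn
  · simp [lapTerm]
  have hn' : (0 : ℝ) < n := by exact_mod_cast hn
  have hk : (0 : ℝ) < (n : ℝ) ^ 2 * Real.pi ^ 2 / 6 := by positivity
  have hz : (n * (Real.pi : ℂ) * (x / 6) ^ (1 / 2 : ℂ)) ^ 2 =
      (((n : ℝ) ^ 2 * Real.pi ^ 2 / 6 : ℝ) : ℂ) * x := by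
    rw [mul_pow, cpow_half_sq]; push_cast; ring
  have hre : 0 < ((n * (Real.pi : ℂ) * (x / 6) ^ (1 / 2 : ℂ)) ^ 2).re := by
    rw [hz, Complex.re_ofReal_mul]; positivity
  have h := norm_modErfi_le hre
  rw [hz, Complex.re_ofReal_mul, norm_mul, Complex.norm_real, Real.norm_of_nonneg hk.le,
    mul_div_mul_left _ _ hk.ne'] at h
  unfold lapTerm
  rw [norm_mul, norm_div, norm_pow, Complex.norm_natCast, mul_comm]
  gcongr
  exact norm_chi12_le n

theorem summable_lapTerm {x : ℂ} (hx : 0 < x.re) : Summable fun n : ℕ => lapTerm n x :=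
  .of_norm_bounded ((Real.summable_one_div_nat_pow.2 one_lt_two).mul_left _) (norm_lapTerm_le hx)

theorem tendstoUniformlyOn_lapTerm {s : Set ℂ} {C : ℝ}
    (hs : ∀ x ∈ s, 0 < x.re ∧ ‖x‖ / x.re ≤ C) :
    TendstoUniformlyOn (fun (M : ℕ) (x : ℂ) => ∑ n ∈ Finset.Icc 1 M, lapTerm n x)
      (fun x => ∑' n : ℕ, lapTerm n x) atTop s := by
  have h := tendstoUniformlyOn_tsum_nat (f := lapTerm) (s := s)
    ((Real.summable_one_div_nat_pow.2 one_lt_two).mul_left (3 * C ^ 2))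
    fun n x hx => (norm_lapTerm_le (hs x hx).1 n).trans (by
      have := (hs x hx).1
      gcongr
      exact (hs x hx).2)
  intro v hv
  filter_upwards [(tendsto_add_atTop_nat 1).eventually (h v hv)] with M hM x hx
  have : ∑ n ∈ Finset.Icc 1 M, lapTerm n x = ∑ n ∈ Finset.range (M + 1), lapTerm n x := by
    rw [Finset.range_eq_Ico, Finset.sum_eq_sum_Ico_succ_bot (Nat.succ_pos M)]
    simp only [lapTerm, Nat.cast_zero, zero_pow two_ne_zero, div_zero, zero_mul, zero_add]
    rfl
  rw [this]
  exact hM x hx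

theorem tendstoLocallyUniformlyOn_lapTerm :
    TendstoLocallyUniformlyOn (fun (M : ℕ) (x : ℂ) => ∑ n ∈ Finset.Icc 1 M, lapTerm n x)
      (fun x => ∑' n : ℕ, lapTerm n x) atTop {x : ℂ | 0 < x.re} := by
  have ho : IsOpen {x : ℂ | 0 < x.re} := isOpen_lt continuous_const Complex.continuous_re
  refine tendstoLocallyUniformlyOn_of_forall_exists_nhds fun x hx => ?_
  have hc : ContinuousAt (fun x : ℂ => ‖x‖ / x.re) x :=
    continuous_norm.continuousAt.div Complex.continuous_re.continuousAt (ne_of_gt hx)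
  refine ⟨{y | 0 < y.re ∧ ‖y‖ / y.re ≤ ‖x‖ / x.re + 1}, mem_nhdsWithin_of_mem_nhds ?_,
    tendstoUniformlyOn_lapTerm fun y hy => hy⟩
  filter_upwards [ho.mem_nhds hx, hc.eventually (gt_mem_nhds (lt_add_one _))] with y h1 h2
  exact ⟨h1, h2.le⟩

/-- Here `‖x‖ / Re x = 1 / cos (arg x) ≤ 1 / cos θ`. For `θ < π/2` the condition `0 < x.re` only
removes the origin from the sector. -/
theorem tendstoUniformlyOn_sector_lapTerm {θ : ℝ} (hθ : θ < Real.pi / 2) :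
    TendstoUniformlyOn (fun (M : ℕ) (x : ℂ) => ∑ n ∈ Finset.Icc 1 M, lapTerm n x)
      (fun x => ∑' n : ℕ, lapTerm n x) atTop {x : ℂ | 0 < x.re ∧ |x.arg| ≤ θ} := by
  refine tendstoUniformlyOn_lapTerm (C := 1 / Real.cos θ) fun x hx => ⟨hx.1, ?_⟩
  have hθ0 : 0 ≤ θ := (abs_nonneg _).trans hx.2
  have hcos : 0 < Real.cos θ := Real.cos_pos_of_mem_Ioo ⟨by linarith, hθ⟩
  have h1 : Real.cos θ ≤ Real.cos x.arg := by
    rw [← Real.cos_abs x.arg]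
    exact Real.cos_le_cos_of_nonneg_of_le_pi (abs_nonneg _) (by linarith) hx.2
  have h2 : ‖x‖ * Real.cos x.arg = x.re := Complex.norm_mul_cos_arg x
  rw [div_le_div_iff₀ hx.1 hcos, ← h2, one_mul]
  gcongr

/-! ### The value `L(2, χ)` -/

/-- Finite Fourier expansion of an even character with Gauss sum `√12`: the residues `1, 11` and `5,
7` pair into cosines. -/
theorem chi12_eq_cos (n : ℕ) :
    chi12 n = ((1 / Real.sqrt 3 *
      (Real.cos (2 * Real.pi * n * (1 / 12)) - Real.cos (2 * Real.pi * n * (5 / 12))) : ℝ) : ℂ) := by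
  have h5 : Real.cos (2 * Real.pi * n * (5 / 12)) =
      (-1) ^ n * Real.cos (2 * Real.pi * n * (1 / 12)) := by
    rw [← Real.cos_nat_mul_pi_sub]
    congr 1
    ring
  have h1 : Real.cos (2 * Real.pi * n * (1 / 12)) = Real.cos ((n % 12 : ℕ) * Real.pi / 6) := by
    have h : (n : ℝ) = (n % 12 : ℕ) + 12 * (n / 12 : ℕ) := by
      exact_mod_cast (Nat.mod_add_div n 12).symm
    have : 2 * Real.pi * n * (1 / 12) =
        (n % 12 : ℕ) * Real.pi / 6 + (n / 12 : ℕ) * (2 * Real.pi) := by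
      rw [h]; ring
    rw [this, Real.cos_add_nat_mul_two_pi]
  have h2 : (-1 : ℝ) ^ n = (-1) ^ (n % 12) := by
    conv_lhs => rw [← Nat.mod_add_div n 12, pow_add, pow_mul]
    norm_num
  have h3 : (Real.sqrt 3 : ℂ) ≠ 0 := by
    exact_mod_cast (by positivity : Real.sqrt 3 ≠ 0)
  have c6 := Real.cos_pi_div_six
  have e3 : (3 : ℝ) * Real.pi / 6 = Real.pi / 2 := by ring
  have e5 : (5 : ℝ) * Real.pi / 6 = Real.pi - Real.pi / 6 := by ring
  have e7 : (7 : ℝ) * Real.pi / 6 = Real.pi / 6 + Real.pi := by ring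
  have e9 : (9 : ℝ) * Real.pi / 6 = Real.pi / 2 + Real.pi := by ring
  have e11 : (11 : ℝ) * Real.pi / 6 = 2 * Real.pi - Real.pi / 6 := by ring
  rw [h5, h1, h2, chi12]
  have hr : n % 12 < 12 := Nat.mod_lt _ (by norm_num)
  generalize n % 12 = r at hr ⊢
  interval_cases r <;>
    simp [-Complex.ofReal_cos, e3, e5, e7, e9, e11, c6, Real.cos_pi_sub, Real.cos_add_pi,
      Real.cos_two_pi_sub] <;>
    field_simp <;> norm_num

/-- By the Fourier series of the Bernoulli polynomial `B₂`, the value is `π² (B₂(1/12) - B₂(5/12)) /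
√3`, and the difference is `1/6`. -/
theorem hasSum_chi12_div_sq :
    HasSum (fun n : ℕ => chi12 n / (n : ℂ) ^ 2) ((Real.pi ^ 2 / (6 * Real.sqrt 3) : ℝ) : ℂ) := by
  have h1 := hasSum_one_div_nat_pow_mul_cos one_ne_zero (x := 1 / 12) (by constructor <;> norm_num)
  have h5 := hasSum_one_div_nat_pow_mul_cos one_ne_zero (x := 5 / 12) (by constructor <;> norm_num)
  have h := Complex.hasSum_ofReal.2 ((h1.sub h5).mul_left (1 / Real.sqrt 3))
  have h3 : Real.sqrt 3 ≠ 0 := by positivity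
  convert h using 1
  · ext n
    rw [chi12_eq_cos]
    push_cast
    ring
  · congr 1
    have hB : ∀ y : ℝ, Polynomial.eval y
        (Polynomial.map (algebraMap ℚ ℝ) (Polynomial.bernoulli (2 * 1))) = y ^ 2 - y + 6⁻¹ :=
      bernoulliFun_two
    simp only [hB, mul_one, Nat.factorial_two]
    field_simp
    norm_num

/-! ### Lateral square roots -/

/-- The branch of `√w` with cut `-ε⁻¹ [0, ∞)`. -/
noncomputable def lateralSqrt (ε w : ℂ) : ℂ := (ε * w) ^ (1 / 2 : ℂ) / ε ^ (1 / 2 : ℂ)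

theorem lateralSqrt_sq {ε : ℂ} (hε : ε ≠ 0) (w : ℂ) : lateralSqrt ε w ^ 2 = w := by
  rw [lateralSqrt, div_pow, cpow_half_sq, cpow_half_sq, mul_div_cancel_left₀ _ hε]

theorem lateralSqrt_ne_zero {ε : ℂ} (hε : ε ≠ 0) {w : ℂ} (hw : w ≠ 0) : lateralSqrt ε w ≠ 0 := by
  intro h
  have := lateralSqrt_sq hε w
  rw [h, zero_pow two_ne_zero] at this
  exact hw this.symm

theorem hasDerivAt_lateralSqrt {ε w : ℂ} (h : ε * w ∈ Complex.slitPlane) :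
    HasDerivAt (lateralSqrt ε) (1 / (2 * lateralSqrt ε w)) w := by
  have hne := Complex.slitPlane_ne_zero h
  have hε : ε ≠ 0 := left_ne_zero_of_mul hne
  have hw : w ≠ 0 := right_ne_zero_of_mul hne
  have hd : HasDerivAt (lateralSqrt ε) _ w :=
    ((((hasDerivAt_id w).const_mul ε).cpow_const (c := (1 / 2 : ℂ)) h).div_const (ε ^ (1 / 2 : ℂ)))
  have h2 := hd.pow 2
  have h3 : lateralSqrt ε ^ 2 = id := by
    ext z
    exact lateralSqrt_sq hε z
  rw [h3] at h2
  have h4 := h2.unique (hasDerivAt_id w)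
  refine hd.congr_deriv ?_
  rw [eq_div_iff (mul_ne_zero two_ne_zero (lateralSqrt_ne_zero hε hw))]
  rw [Nat.cast_ofNat, pow_one] at h4
  linear_combination h4

theorem lateralSqrt_ofReal_mul (ε : ℂ) {t : ℝ} (ht : 0 < t) (w : ℂ) :
    lateralSqrt ε ((t : ℂ) * w) = (Real.sqrt t : ℂ) * lateralSqrt ε w := by
  rcases eq_or_ne (ε * w) 0 with h | h
  · have : ε * ((t : ℂ) * w) = 0 := by rw [mul_left_comm, h, mul_zero]
    rw [lateralSqrt, lateralSqrt, this, h]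
    simp
  · rw [lateralSqrt, lateralSqrt, mul_left_comm, ← mul_div_assoc]
    congr 1
    have ht' : (t : ℂ) ≠ 0 := by exact_mod_cast ht.ne'
    rw [Complex.cpow_def_of_ne_zero (mul_ne_zero ht' h), Complex.cpow_def_of_ne_zero h,
      Complex.log_ofReal_mul ht h, add_mul, Complex.exp_add, Real.sqrt_eq_rpow,
      Complex.ofReal_cpow ht.le, Complex.cpow_def_of_ne_zero ht', Complex.ofReal_log ht.le]
    push_cast
    rfl

/-- `ε` is `I` for continuation through the upper half-plane and `-I` for the lower one. -/
def IsLateral (ε : ℂ) : Prop := ε = Complex.I ∨ ε = -Complex.I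

namespace IsLateral

variable {ε : ℂ}

theorem sq (hε : IsLateral ε) : ε ^ 2 = -1 := by rcases hε with rfl | rfl <;> simp
theorem ne_zero (hε : IsLateral ε) : ε ≠ 0 := by rcases hε with rfl | rfl <;> simp
theorem norm (hε : IsLateral ε) : ‖ε‖ = 1 := by rcases hε with rfl | rfl <;> simp
theorem re (hε : IsLateral ε) : ε.re = 0 := by rcases hε with rfl | rfl <;> simp

theorem neg_mem_slitPlane (hε : IsLateral ε) : ε * (-1) ∈ Complex.slitPlane := by
  rcases hε with rfl | rfl <;> simp [Complex.mem_slitPlane_iff]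

/-- The arguments of `ε` and `w` add without leaving `(-π, π)`. Hence both lateral branches start
from the same principal germ at `p = 0`. -/
theorem lateralSqrt_eq_cpow (hε : IsLateral ε) {w : ℂ} (hw : 0 < w.re) : lateralSqrt ε w = w ^ (1 / 2 : ℂ) := by
  have hw0 : w ≠ 0 := by rintro rfl; simp at hw
  have ha := abs_lt.1 (Complex.abs_arg_lt_pi_div_two_iff.2 (Or.inl hw))
  have hl : Complex.log (ε * w) = Complex.log ε + Complex.log w := by
    refine Complex.log_mul hε.ne_zero hw0 ?_
    rcases hε with rfl | rfl
    · rw [Complex.arg_I]; constructor <;> linarith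
    · rw [Complex.arg_neg_I]; constructor <;> linarith
  rw [lateralSqrt, Complex.cpow_def_of_ne_zero (mul_ne_zero hε.ne_zero hw0),
    Complex.cpow_def_of_ne_zero hε.ne_zero, Complex.cpow_def_of_ne_zero hw0, hl, add_mul,
    Complex.exp_add, mul_div_cancel_left₀ _ (Complex.exp_ne_zero _)]

theorem lateralSqrt_neg_one (hε : IsLateral ε) : lateralSqrt ε (-1) = -ε := by
  have hl : Complex.log (ε * (-1)) = -Complex.log ε := by
    rcases hε with rfl | rfl <;> simp [Complex.log_I, Complex.log_neg_I]
  have hl2 : Complex.log (-ε) = -Complex.log ε := by rw [← hl, mul_neg_one]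
  rw [lateralSqrt, Complex.cpow_def_of_ne_zero (mul_ne_zero hε.ne_zero (by simp)),
    Complex.cpow_def_of_ne_zero hε.ne_zero, hl, ← Complex.exp_sub]
  conv_rhs => rw [← Complex.exp_log (neg_ne_zero.2 hε.ne_zero), hl2]
  congr 1
  ring

end IsLateral

theorem cpow_half_re_pos {x : ℂ} (hx : x ∈ Complex.slitPlane) : 0 < (x ^ (1 / 2 : ℂ)).re := by
  rw [Complex.cpow_def_of_ne_zero (Complex.slitPlane_ne_zero hx), Complex.exp_re]
  refine mul_pos (Real.exp_pos _) (Real.cos_pos_of_mem_Ioo ?_)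
  have h : (Complex.log x * (1 / 2)).im = x.arg / 2 := by
    have : (1 / 2 : ℂ) = ((1 / 2 : ℝ) : ℂ) := by push_cast; rfl
    rw [this, mul_comm, Complex.im_ofReal_mul, Complex.log_im]
    ring
  rw [h]
  have h1 := Complex.neg_pi_lt_arg x
  have h2 := lt_of_le_of_ne (Complex.arg_le_pi x) (Complex.mem_slitPlane_iff_arg.1 hx).1
  constructor <;> linarith

theorem cpow_five_halves (x : ℂ) : x ^ (5 / 2 : ℂ) = (x ^ (1 / 2 : ℂ)) ^ 5 := by
  rw [← Complex.cpow_nat_mul]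
  norm_num

/-! ### Lateral Laplace integrals of `(η - p) ^ (-5 / 2)` -/

theorem sqrt_pi_ne_zero : (Real.sqrt Real.pi : ℂ) ≠ 0 := by
  exact_mod_cast (Real.sqrt_pos.2 Real.pi_pos).ne'

/-- A primitive of `exp (u² r²) / u⁴`. -/
noncomputable def expPrimitive (r u : ℂ) : ℂ :=
  -Complex.exp (u ^ 2 * r ^ 2) / (3 * u ^ 3) - 2 * r ^ 2 / 3 * (Complex.exp (u ^ 2 * r ^ 2) / u) +
    2 * (Real.sqrt Real.pi : ℂ) * r ^ 3 / 3 * erfi (u * r)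

/-- Two integrations by parts reduce `u⁻⁴` to `u⁻²` and then to `1`, where `erfi` is the primitive.
-/
theorem hasDerivAt_expPrimitive (r : ℂ) {u : ℂ} (hu : u ≠ 0) :
    HasDerivAt (expPrimitive r) (Complex.exp (u ^ 2 * r ^ 2) / u ^ 4) u := by
  have he : HasDerivAt (fun u : ℂ => Complex.exp (u ^ 2 * r ^ 2))
      (Complex.exp (u ^ 2 * r ^ 2) * (2 * u * r ^ 2)) u := by
    simpa using (((hasDerivAt_id u).pow 2).mul_const (r ^ 2)).cexp
  have h3 : HasDerivAt (fun u : ℂ => 3 * u ^ 3) (9 * u ^ 2) u := by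
    refine (((hasDerivAt_id u).pow 3).const_mul 3).congr_deriv ?_
    simp
    ring
  have hm : HasDerivAt (fun u : ℂ => u * r) r u := by
    simpa using (hasDerivAt_id u).mul_const r
  have hf := (hasDerivAt_erfi (u * r)).comp u hm
  have h := ((he.neg.div h3 (by simpa using hu)).sub
    ((he.div (hasDerivAt_id u) hu).const_mul (2 * r ^ 2 / 3))).add
    (hf.const_mul (2 * (Real.sqrt Real.pi : ℂ) * r ^ 3 / 3))
  refine h.congr_deriv ?_
  have hp := sqrt_pi_ne_zero
  simp only [id, Pi.neg_apply, mul_pow]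
  field_simp
  ring

/-- Substitution `u = √(η - p)`: `p = η - u²` and `dp = -2u du`. -/
theorem hasDerivAt_lateralPrimitive {ε : ℂ} (r η p : ℂ) (h : ε * (η - p) ∈ Complex.slitPlane) :
    HasDerivAt (fun p => -2 * Complex.exp (-(r ^ 2 * η)) * expPrimitive r (lateralSqrt ε (η - p)))
      (Complex.exp (-(r ^ 2 * p)) / lateralSqrt ε (η - p) ^ 5) p := by
  have hne := Complex.slitPlane_ne_zero h
  have hε : ε ≠ 0 := left_ne_zero_of_mul hne
  have hu := lateralSqrt_ne_zero hε (right_ne_zero_of_mul hne)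
  have h1 : HasDerivAt (fun p => lateralSqrt ε (η - p)) _ p :=
    (hasDerivAt_lateralSqrt h).comp p ((hasDerivAt_id p).const_sub η)
  have h2 := ((hasDerivAt_expPrimitive r hu).comp p h1).const_mul
    (-2 * Complex.exp (-(r ^ 2 * η)))
  refine h2.congr_deriv ?_
  have : Complex.exp (-(r ^ 2 * p)) =
      Complex.exp (-(r ^ 2 * η)) * Complex.exp (lateralSqrt ε (η - p) ^ 2 * r ^ 2) := by
    rw [lateralSqrt_sq hε, ← Complex.exp_add]
    congr 1
    ring
  rw [this]
  field_simp

section limits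

variable {ε r η : ℂ} {γ : ℝ → ℂ}

theorem tendsto_lateralSqrt_div_sqrt (hε : IsLateral ε)
    (hγ : Tendsto (fun t : ℝ => γ t / (t : ℂ)) atTop (𝓝 1)) :
    Tendsto (fun t => lateralSqrt ε (η - γ t) / (Real.sqrt t : ℂ)) atTop (𝓝 (-ε)) := by
  have h0 : Tendsto (fun t : ℝ => η / (t : ℂ)) atTop (𝓝 0) := by
    have := (tendsto_inv_atTop_zero (𝕜 := ℝ)).ofReal.const_mul η
    simpa [div_eq_mul_inv] using this
  have h1 := h0.sub hγ
  rw [zero_sub] at h1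
  have hc : ContinuousAt (lateralSqrt ε) (-1) :=
    (hasDerivAt_lateralSqrt hε.neg_mem_slitPlane).continuousAt
  have h2 := hc.tendsto.comp h1
  rw [hε.lateralSqrt_neg_one] at h2
  refine h2.congr' ?_
  filter_upwards [eventually_gt_atTop 0] with t ht
  have ht' : (t : ℂ) ≠ 0 := by exact_mod_cast ht.ne'
  have hs : (Real.sqrt t : ℂ) ≠ 0 := by exact_mod_cast (Real.sqrt_pos.2 ht).ne'
  have : η - γ t = (t : ℂ) * (η / t - γ t / t) := by field_simp
  rw [this, lateralSqrt_ofReal_mul ε ht, mul_div_cancel_left₀ _ hs]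
  rfl

theorem exists_mul_le_re_mul (hγ : Tendsto (fun t : ℝ => γ t / (t : ℂ)) atTop (𝓝 1)) {x : ℂ}
    (hx : 0 < x.re) (c : ℂ) : ∀ᶠ t : ℝ in atTop, x.re / 2 * t ≤ (x * (γ t - c)).re := by
  have h0 : Tendsto (fun t : ℝ => c / (t : ℂ)) atTop (𝓝 0) := by
    have := (tendsto_inv_atTop_zero (𝕜 := ℝ)).ofReal.const_mul c
    simpa [div_eq_mul_inv] using this
  have h1 := (hγ.sub h0).const_mul x
  rw [sub_zero, mul_one] at h1
  have h2 := (Complex.continuous_re.tendsto x).comp h1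
  filter_upwards [h2.eventually (lt_mem_nhds (half_lt_self hx)), eventually_gt_atTop 0] with t h ht
  have ht' : (t : ℂ) ≠ 0 := by exact_mod_cast ht.ne'
  have : x * (γ t - c) = (t : ℂ) * (x * (γ t / t - c / t)) := by field_simp
  rw [this, Complex.re_ofReal_mul, mul_comm]
  exact mul_le_mul_of_nonneg_left h.le ht.le

/-- With `u = lateralSqrt ε (η - γ t)` and `W = u r ε`, `ε² = -1` gives `u r = -ε W` and `W ~ r√t`.
So `erfi (u r)` is `-ε` times `2/√π` times a Gaussian integral up to `W`, whose real part tends to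
infinity. -/
theorem tendsto_erfi_lateralSqrt (hε : IsLateral ε) (hr : 0 < r.re) (hx : 0 < (r ^ 2).re)
    (hγ : Tendsto (fun t : ℝ => γ t / (t : ℂ)) atTop (𝓝 1)) :
    Tendsto (fun t => erfi (lateralSqrt ε (η - γ t) * r)) atTop (𝓝 (-ε)) := by
  set W : ℝ → ℂ := fun t => lateralSqrt ε (η - γ t) * r * ε with hW
  have h1 : Tendsto (fun t => W t / (Real.sqrt t : ℂ)) atTop (𝓝 r) := by
    have h := (tendsto_lateralSqrt_div_sqrt (η := η) hε hγ).mul_const (r * ε)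
    have e : -ε * (r * ε) = r := by linear_combination -r * hε.sq
    rw [e] at h
    refine h.congr fun t => ?_
    rw [hW]
    ring
  have hre : Tendsto (fun t => (W t).re) atTop atTop := by
    have h2 := ((Complex.continuous_re.tendsto r).comp h1).pos_mul_atTop hr Real.tendsto_sqrt_atTop
    refine h2.congr' ?_
    filter_upwards [eventually_gt_atTop 0] with t ht
    have hs : Real.sqrt t ≠ 0 := (Real.sqrt_pos.2 ht).ne'
    simp only [Function.comp, Complex.div_ofReal_re]
    field_simp
  have hsq : ∀ t, W t ^ 2 = r ^ 2 * (γ t - η) := fun t => by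
    rw [hW]
    simp only [mul_pow, lateralSqrt_sq hε.ne_zero, hε.sq]
    ring
  have him : Tendsto (fun t => ‖W t‖ * Real.exp (-(W t ^ 2).re)) atTop (𝓝 0) := by
    have h3 := h1.norm.mul
      (tendsto_rpow_mul_exp_neg_mul_atTop_nhds_zero (1 / 2) ((r ^ 2).re / 2) (half_pos hx))
    rw [mul_zero] at h3
    refine squeeze_zero' (.of_forall fun t => by positivity) ?_ h3
    filter_upwards [exists_mul_le_re_mul hγ hx η, eventually_gt_atTop 0] with t h ht
    have hs : Real.sqrt t ≠ 0 := (Real.sqrt_pos.2 ht).ne'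
    rw [norm_div, Complex.norm_real, Real.norm_of_nonneg (Real.sqrt_nonneg t),
      ← Real.sqrt_eq_rpow, ← mul_assoc, div_mul_cancel₀ _ hs, hsq, neg_mul]
    gcongr
  have h4 := (tendsto_integral_segment_gaussian hre him).const_mul
    (2 / (Real.sqrt Real.pi : ℂ) * (-ε))
  have hp := sqrt_pi_ne_zero
  have e : 2 / (Real.sqrt Real.pi : ℂ) * (-ε) * ((Real.sqrt Real.pi / 2 : ℝ) : ℂ) = -ε := by
    push_cast
    field_simp
  rw [e] at h4
  refine h4.congr fun t => ?_
  have hu : lateralSqrt ε (η - γ t) * r = -ε * W t := by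
    rw [hW]
    linear_combination lateralSqrt ε (η - γ t) * r * hε.sq
  rw [erfi, hu, mul_assoc, ← intervalIntegral.integral_const_mul]
  congr 2
  ext s
  have : ((s : ℂ) * (-ε * W t)) ^ 2 = -((s : ℂ) * W t) ^ 2 := by
    linear_combination ((s : ℂ) * W t) ^ 2 * hε.sq
  rw [this]
  ring

theorem tendsto_expPrimitive_lateralSqrt (hε : IsLateral ε) (hr : 0 < r.re) (hx : 0 < (r ^ 2).re)
    (hγ : Tendsto (fun t : ℝ => γ t / (t : ℂ)) atTop (𝓝 1)) :
    Tendsto (fun t => expPrimitive r (lateralSqrt ε (η - γ t))) atTop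
      (𝓝 (2 * (Real.sqrt Real.pi : ℂ) * r ^ 3 / 3 * (-ε))) := by
  set u : ℝ → ℂ := fun t => lateralSqrt ε (η - γ t)
  have hinv : Tendsto (fun t => (u t)⁻¹) atTop (𝓝 0) := by
    have h1 := (tendsto_lateralSqrt_div_sqrt (η := η) hε hγ).inv₀ (neg_ne_zero.2 hε.ne_zero)
    have h2 := (tendsto_inv_atTop_zero.comp Real.tendsto_sqrt_atTop).ofReal.mul h1
    rw [Complex.ofReal_zero, zero_mul] at h2
    refine h2.congr' ?_
    filter_upwards [eventually_gt_atTop 0] with t ht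
    have hs : (Real.sqrt t : ℂ) ≠ 0 := by exact_mod_cast (Real.sqrt_pos.2 ht).ne'
    simp only [Function.comp, Complex.ofReal_inv, inv_div]
    field_simp
    rfl
  have hexp : Tendsto (fun t => Complex.exp (u t ^ 2 * r ^ 2)) atTop (𝓝 0) := by
    refine tendsto_zero_iff_norm_tendsto_zero.2 ?_
    refine squeeze_zero' (.of_forall fun t => norm_nonneg _) ?_
      (Real.tendsto_exp_neg_atTop_nhds_zero.comp
        (tendsto_id.const_mul_atTop (half_pos hx)))
    filter_upwards [exists_mul_le_re_mul hγ hx η] with t h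
    rw [Complex.norm_exp, lateralSqrt_sq hε.ne_zero]
    refine Real.exp_le_exp.2 ?_
    have : (η - γ t) * r ^ 2 = -(r ^ 2 * (γ t - η)) := by ring
    rw [this, Complex.neg_re]
    exact neg_le_neg h
  have h := ((((hexp.neg.mul (hinv.pow 3)).mul_const (1 / 3)).sub
    ((hexp.mul hinv).const_mul (2 * r ^ 2 / 3))).add
    ((tendsto_erfi_lateralSqrt (η := η) hε hr hx hγ).const_mul
      (2 * (Real.sqrt Real.pi : ℂ) * r ^ 3 / 3)))
  simp only [mul_zero, neg_zero, zero_mul, sub_zero, zero_add] at h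
  refine h.congr fun t => ?_
  unfold expPrimitive
  rw [div_eq_mul_inv _ (3 * _), mul_inv, inv_pow, div_eq_mul_inv _ (lateralSqrt _ _)]
  ring

end limits

/-- On the correct side of the real axis `ε (η - p)` lies in the closed right half-plane, which
meets the cut only at `0`. -/
theorem IsLateral.mul_mem_slitPlane {ε p : ℂ} {η : ℝ} (hε : IsLateral ε) (hp : (ε * p).re ≤ 0)
    (hne : p ≠ η) : ε * (η - p) ∈ Complex.slitPlane := by
  have h0 : ε * (η - p) ≠ 0 := mul_ne_zero hε.ne_zero (sub_ne_zero.2 hne.symm)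
  have hre : 0 ≤ (ε * (η - p)).re := by
    rw [mul_sub, Complex.sub_re, Complex.re_mul_ofReal, hε.re]
    linarith
  rw [Complex.mem_slitPlane_iff]
  by_contra! h
  exact h0 (Complex.ext (le_antisymm h.1 hre) h.2)

theorem integral_lateral {ε r : ℂ} {η : ℝ} {N : Set ℂ} {γ : ℝ → ℂ} (hε : IsLateral ε)
    (hr : 0 < r.re) (hx : 0 < (r ^ 2).re) (hη : 0 < η) (hγ : IsLaplacePath N γ)
    (hside : ∀ t, 0 ≤ t → (ε * γ t).re ≤ 0) (hηγ : ∀ t, 0 ≤ t → γ t ≠ η)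
    (hint : IntegrableOn (fun t => Complex.exp (-(r ^ 2 * γ t)) / lateralSqrt ε (η - γ t) ^ 5 *
      deriv γ t) (Ioi 0)) :
    ∫ t in Ioi (0 : ℝ), Complex.exp (-(r ^ 2 * γ t)) / lateralSqrt ε (η - γ t) ^ 5 * deriv γ t =
      2 * Complex.exp (-(r ^ 2 * η)) * (expPrimitive r (Real.sqrt η) +
        2 * (Real.sqrt Real.pi : ℂ) * r ^ 3 / 3 * ε) := by
  obtain ⟨S, hS, hd⟩ := hγ.differentiable
  set F : ℂ → ℂ := fun p =>
    -2 * Complex.exp (-(r ^ 2 * η)) * expPrimitive r (lateralSqrt ε (η - p)) with hF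
  have hFd : ∀ t, 0 ≤ t → HasDerivAt F _ (γ t) := fun t ht =>
    hasDerivAt_lateralPrimitive r η (γ t) (hε.mul_mem_slitPlane (hside t ht) (hηγ t ht))
  have hFTC : ∀ T : ℝ, 0 ≤ T → ∫ t in (0 : ℝ)..T,
      Complex.exp (-(r ^ 2 * γ t)) / lateralSqrt ε (η - γ t) ^ 5 * deriv γ t =
      F (γ T) - F (γ 0) := fun T hT => by
    -- The path may have countably many corners; continuity of the primitive along it suffices
    -- there.
    refine integral_eq_of_hasDerivAt_off_countable_of_le (fun t => F (γ t)) _ hT hS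
      (fun t ht => ?_) (fun t ht => ?_) ?_
    · exact (hFd t ht.1).continuousAt.comp_continuousWithinAt
        ((hγ.continuousOn t ht.1).mono fun s hs => hs.1)
    · exact (hFd t ht.1.1.le).comp t (hd t ht.1.1 ht.2).hasDerivAt
    · exact (intervalIntegrable_iff_integrableOn_Ioc_of_le hT).2
        (hint.mono_set fun s hs => hs.1)
  have h1 := intervalIntegral_tendsto_integral_Ioi 0 hint tendsto_id
  have h2 : Tendsto (fun T => F (γ T) - F (γ 0)) atTop (𝓝 _) :=
    ((tendsto_expPrimitive_lateralSqrt hε hr hx hγ.to_infinity).const_mul _).sub_const _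
  have h3 := h2.congr' (by
    filter_upwards [eventually_ge_atTop 0] with T hT
    exact (hFTC T hT).symm)
  rw [tendsto_nhds_unique h1 h3]
  have h4 : lateralSqrt ε (η - γ 0) = (Real.sqrt η : ℂ) := by
    rw [hγ.start, sub_zero, hε.lateralSqrt_eq_cpow (by simpa using hη), Real.sqrt_eq_rpow,
      Complex.ofReal_cpow hη.le]
    push_cast
    rfl
  rw [hF]
  simp only [h4]
  ring

/-! ### The lateral continuations of the Borel transform -/

/-- The singularity `n² π² / 6` as a real number. -/
noncomputable def singularPoint (n : ℕ) : ℝ := (n : ℝ) ^ 2 * Real.pi ^ 2 / 6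

theorem ofReal_singularPoint (n : ℕ) :
    (singularPoint n : ℂ) = (n : ℂ) ^ 2 * (Real.pi : ℂ) ^ 2 / 6 := by
  rw [singularPoint]
  push_cast
  rfl

theorem sq_le_singularPoint (n : ℕ) : (n : ℝ) ^ 2 ≤ singularPoint n := by
  rw [singularPoint, mul_div_assoc]
  refine le_mul_of_one_le_right (by positivity) ?_
  rw [one_le_div (by norm_num)]
  nlinarith [Real.pi_gt_three]

theorem singularPoint_mem {n : ℕ} (hn : chi12 n ≠ 0) : (singularPoint n : ℂ) ∈ singularSet := by
  refine ⟨n, ?_, ofReal_singularPoint n⟩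
  by_contra! h
  simp [chi12, h] at hn

theorem pos_of_chi12_ne_zero {n : ℕ} (hn : chi12 n ≠ 0) : 0 < n := by
  rcases Nat.eq_zero_or_pos n with rfl | h
  · simp [chi12] at hn
  · exact h

/-- The term of the series of `lateralG`. -/
noncomputable def lateralTerm (ε : ℂ) (n : ℕ) (p : ℂ) : ℂ :=
  chi12 n * n / lateralSqrt ε (singularPoint n - p) ^ 5

/-- The continuation of `borelG` through the half-plane `Re (ε p) ≤ 0`. -/
noncomputable def lateralG (ε p : ℂ) : ℂ :=
  3 * (Real.pi : ℂ) / (2 * (Real.sqrt 2 : ℂ)) * ∑' n : ℕ, lateralTerm ε n p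

theorem lateralTerm_of_chi12_eq_zero {n : ℕ} (hn : chi12 n = 0) (ε p : ℂ) :
    lateralTerm ε n p = 0 := by
  simp [lateralTerm, hn]

theorem norm_lateralTerm_le {ε p : ℂ} {δ R : ℝ} (hε : IsLateral ε) (hδ : 0 < δ) (hδR : δ ≤ R)
    (hp : ‖p‖ ≤ R) (hN : ∀ η ∈ singularSet, δ ≤ ‖p - η‖) (n : ℕ) :
    ‖lateralTerm ε n p‖ ≤ (2 * R / δ) ^ 5 * (1 / (n : ℝ) ^ 4) := by
  have hR : 0 < R := hδ.trans_le hδR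
  by_cases hn : chi12 n = 0
  · rw [lateralTerm_of_chi12_eq_zero hn, norm_zero]
    positivity
  have hn1 : (1 : ℝ) ≤ n := by exact_mod_cast pos_of_chi12_ne_zero hn
  -- This `b` gives `|η - p| ≥ b n²` in both regimes: if `n² ≥ 2R` then `|η| - |p| ≥ n²/2`,
  -- otherwise `δ = 2R b ≥ b n²`. Since `b ≤ 1`, the square root is at least `b n`.
  set b := δ / (2 * R) with hb
  have hb0 : 0 < b := by positivity
  have hb1 : b ≤ 1 / 2 := by
    rw [hb, div_le_div_iff₀ (by positivity) (by norm_num)]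
    linarith
  have hd : b * (n : ℝ) ^ 2 ≤ ‖(singularPoint n : ℂ) - p‖ := by
    rcases le_total (2 * R) ((n : ℝ) ^ 2) with h | h
    · have h1 := norm_sub_norm_le (singularPoint n : ℂ) p
      rw [Complex.norm_real, Real.norm_eq_abs] at h1
      have h2 := le_abs_self (singularPoint n)
      have h3 := sq_le_singularPoint n
      nlinarith
    · rw [norm_sub_rev]
      refine le_trans ?_ (hN _ (singularPoint_mem hn))
      calc b * (n : ℝ) ^ 2 ≤ b * (2 * R) := by gcongr
        _ = δ := by rw [hb]; field_simp
  have hu : b * n ≤ ‖lateralSqrt ε (singularPoint n - p)‖ := by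
    refine le_of_sq_le_sq ?_ (norm_nonneg _)
    rw [← norm_pow, lateralSqrt_sq hε.ne_zero, mul_pow]
    refine le_trans ?_ hd
    gcongr
    nlinarith
  have hbn : 0 < b * n := by positivity
  rw [lateralTerm, norm_div, norm_mul, norm_pow, Complex.norm_natCast]
  calc ‖chi12 n‖ * n / ‖lateralSqrt ε (singularPoint n - p)‖ ^ 5 ≤ 1 * n / (b * n) ^ 5 := by
        gcongr
        exact norm_chi12_le n
    _ = (2 * R / δ) ^ 5 * (1 / (n : ℝ) ^ 4) := by
        rw [hb]
        field_simp

theorem summable_lateral_bound (C : ℝ) : Summable fun n : ℕ => C * (1 / (n : ℝ) ^ 4) :=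
  (Real.summable_one_div_nat_pow.2 (by norm_num)).mul_left C

/-- A point of the closed right half-plane is at least as far from the cut as from `0`. So the ball
of radius `δ` avoids the cuts of all terms at once, even when `p₀` is real. -/
theorem IsLateral.mul_mem_slitPlane_of_near {ε p₀ p : ℂ} {η δ : ℝ} (hε : IsLateral ε)
    (hp₀ : (ε * p₀).re ≤ 0) (hδ : δ ≤ ‖p₀ - η‖) (hp : ‖p - p₀‖ < δ) :
    ε * (η - p) ∈ Complex.slitPlane := by
  rw [Complex.mem_slitPlane_iff]
  by_contra! h
  have hv₀ : 0 ≤ (ε * (η - p₀)).re := by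
    rw [mul_sub, Complex.sub_re, Complex.re_mul_ofReal, hε.re]
    linarith
  have h1 : ‖ε * (η - p₀)‖ ≤ ‖ε * (η - p₀) - ε * (η - p)‖ := by
    refine le_of_sq_le_sq ?_ (norm_nonneg _)
    rw [← Complex.normSq_eq_norm_sq, ← Complex.normSq_eq_norm_sq, Complex.normSq_apply,
      Complex.normSq_apply, Complex.sub_re, Complex.sub_im, h.2, sub_zero]
    nlinarith [h.1]
  rw [← mul_sub, norm_mul, norm_mul, hε.norm, one_mul, one_mul, sub_sub_sub_cancel_left,
    norm_sub_rev] at h1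
  linarith

theorem differentiableAt_lateralTerm {ε p : ℂ} {n : ℕ}
    (h : chi12 n ≠ 0 → ε * (singularPoint n - p) ∈ Complex.slitPlane) :
    DifferentiableAt ℂ (lateralTerm ε n) p := by
  by_cases hn : chi12 n = 0
  · have : lateralTerm ε n = fun _ => 0 := funext fun q => lateralTerm_of_chi12_eq_zero hn ε q
    rw [this]
    exact differentiableAt_const 0
  · have hs := h hn
    have hne := Complex.slitPlane_ne_zero hs
    have h1 : DifferentiableAt ℂ (fun p => lateralSqrt ε (singularPoint n - p)) p :=
      ((hasDerivAt_lateralSqrt hs).comp p ((hasDerivAt_id p).const_sub _)).differentiableAt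
    exact (differentiableAt_const _).div (h1.pow 5) (pow_ne_zero 5
      (lateralSqrt_ne_zero (left_ne_zero_of_mul hne) (right_ne_zero_of_mul hne)))

theorem analyticAt_lateralG {ε p₀ : ℂ} {δ : ℝ} (hε : IsLateral ε) (hp₀ : (ε * p₀).re ≤ 0)
    (hδ : 0 < δ) (hN : ∀ η ∈ singularSet, δ ≤ ‖p₀ - η‖) : AnalyticAt ℂ (lateralG ε) p₀ := by
  have hd : DifferentiableOn ℂ (fun p => ∑' n : ℕ, lateralTerm ε n p)
      (Metric.ball p₀ (δ / 2)) := by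
    refine Complex.differentiableOn_tsum_of_summable_norm
      (summable_lateral_bound ((2 * (‖p₀‖ + δ) / (δ / 2)) ^ 5)) (fun n p hp => ?_)
      Metric.isOpen_ball fun n p hp => ?_
    · refine (differentiableAt_lateralTerm fun hn => ?_).differentiableWithinAt
      refine hε.mul_mem_slitPlane_of_near hp₀ (hN _ (singularPoint_mem hn)) ?_
      have := mem_ball_iff_norm.1 hp
      linarith
    · have hp' := mem_ball_iff_norm.1 hp
      refine norm_lateralTerm_le hε (half_pos hδ) (by linarith [norm_nonneg p₀]) ?_
        (fun η hη => ?_) n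
      · have := norm_sub_norm_le p p₀
        linarith
      · have h1 := hN η hη
        have h2 := norm_sub_le_norm_sub_add_norm_sub p₀ p η
        rw [norm_sub_rev p₀ p] at h2
        linarith
  exact (hd.const_mul _).analyticAt (Metric.ball_mem_nhds p₀ (half_pos hδ))

theorem lateralG_eventuallyEq_borelG {ε : ℂ} (hε : IsLateral ε) :
    lateralG ε =ᶠ[𝓝 0] borelG := by
  -- All singularities with `n ≥ 1` are at least `n² ≥ 1`, so `Re (η - p) > 0` for every such term.
  have ho : ∀ᶠ p : ℂ in 𝓝 0, p.re < 1 :=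
    Complex.continuous_re.continuousAt.eventually (gt_mem_nhds (by simp))
  filter_upwards [ho] with p hp
  unfold lateralG borelG
  congr 2
  ext n
  by_cases hn : chi12 n = 0
  · rw [lateralTerm_of_chi12_eq_zero hn, hn, zero_mul, zero_div]
  have hn1 : (1 : ℝ) ≤ n := by exact_mod_cast pos_of_chi12_ne_zero hn
  have hre : 0 < ((singularPoint n : ℂ) - p).re := by
    rw [Complex.sub_re, Complex.ofReal_re]
    nlinarith [sq_le_singularPoint n]
  rw [lateralTerm, hε.lateralSqrt_eq_cpow hre, ← cpow_five_halves, ofReal_singularPoint]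
  congr 2
  ring

theorem isContinuationAlong_lateralG {ε : ℂ} {γ : ℝ → ℂ} (hε : IsLateral ε)
    (hγ : IsLaplacePath singularSet γ) (hside : ∀ t, 0 ≤ t → (ε * γ t).re ≤ 0) :
    IsContinuationAlong borelG γ fun t => lateralG ε (γ t) := by
  obtain ⟨δ, hδ, hN⟩ := hγ.avoids
  refine ⟨fun _ => lateralG ε, ?_, fun t ht => analyticAt_lateralG hε (hside t ht) hδ (hN t ht),
    fun t _ => .of_forall fun _ => .rfl, fun _ _ => rfl⟩
  rw [hγ.start]
  exact lateralG_eventuallyEq_borelG hε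

/-! ### Laplace integrals along lateral paths -/

theorem exists_le_mul_of_eventually_le {f g : ℝ → ℝ} (hf : ContinuousOn f (Ici 0))
    (hg : ContinuousOn g (Ici 0)) (hg0 : ∀ t, 0 ≤ t → 0 < g t) {C : ℝ}
    (h : ∀ᶠ t in atTop, f t ≤ C * g t) : ∃ K : ℝ, 1 ≤ K ∧ ∀ t, 0 ≤ t → f t ≤ K * g t := by
  obtain ⟨T, hT⟩ := eventually_atTop.1 h
  have hc : ContinuousOn (fun t => f t / g t) (Icc 0 T) :=
    (hf.div hg fun t ht => (hg0 t ht).ne').mono fun t ht => ht.1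
  obtain ⟨M, hM⟩ := isCompact_Icc.bddAbove_image hc
  refine ⟨max 1 (max M C), le_max_left _ _, fun t ht => ?_⟩
  rcases le_total T t with h | h
  · refine (hT t h).trans (mul_le_mul_of_nonneg_right ?_ (hg0 t ht).le)
    exact (le_max_right _ _).trans (le_max_right _ _)
  · rw [← div_le_iff₀ (hg0 t ht)]
    exact (hM ⟨t, ⟨ht, h⟩, rfl⟩).trans ((le_max_left _ _).trans (le_max_right _ _))

theorem IsLaplacePath.exists_norm_le {N : Set ℂ} {γ : ℝ → ℂ} (hγ : IsLaplacePath N γ) :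
    ∃ K : ℝ, 1 ≤ K ∧ ∀ t, 0 ≤ t → ‖γ t‖ ≤ K * (1 + t) := by
  refine exists_le_mul_of_eventually_le (C := 2) hγ.continuousOn.norm (by fun_prop)
    (fun t ht => by positivity) ?_
  have h := hγ.to_infinity.norm
  rw [norm_one] at h
  filter_upwards [h.eventually (gt_mem_nhds one_lt_two), eventually_gt_atTop 0] with t h1 ht
  rw [norm_div, Complex.norm_real, Real.norm_of_nonneg ht.le, div_lt_iff₀ ht] at h1
  linarith

theorem IsLaplacePath.exists_norm_exp_le {N : Set ℂ} {γ : ℝ → ℂ} (hγ : IsLaplacePath N γ) {x : ℂ}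
    (hx : 0 < x.re) : ∃ K : ℝ, 1 ≤ K ∧
      ∀ t, 0 ≤ t → ‖Complex.exp (-(x * γ t))‖ ≤ K * Real.exp (-(x.re / 2 * t)) := by
  have hc := hγ.continuousOn
  refine exists_le_mul_of_eventually_le (C := 1) (by fun_prop) (by fun_prop)
    (fun t ht => by positivity) ?_
  filter_upwards [exists_mul_le_re_mul hγ.to_infinity hx 0] with t h
  rw [sub_zero] at h
  rw [Complex.norm_exp, one_mul, Complex.neg_re]
  exact Real.exp_le_exp.2 (neg_le_neg h)

theorem integrableOn_pow_mul_exp_neg (k : ℕ) {a : ℝ} (ha : 0 < a) :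
    IntegrableOn (fun t : ℝ => (1 + t) ^ k * Real.exp (-(a * t))) (Ioi 0) := by
  refine integrable_of_isBigO_exp_neg (half_pos ha) (by fun_prop) ?_
  have h1 : (fun t : ℝ => (1 + t) ^ k) =o[atTop] fun t => Real.exp (a / 2 * (1 + t)) :=
    (isLittleO_pow_exp_pos_mul_atTop k (half_pos ha)).comp_tendsto
      (tendsto_atTop_add_const_left _ 1 tendsto_id)
  have h2 := h1.isBigO.mul (Asymptotics.isBigO_refl (fun t : ℝ => Real.exp (-(a * t))) atTop)
  refine h2.trans (Asymptotics.IsBigO.of_bound (Real.exp (a / 2)) (.of_forall fun t => ?_))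
  rw [← Real.exp_add, Real.norm_of_nonneg (Real.exp_pos _).le,
    Real.norm_of_nonneg (Real.exp_pos _).le, ← Real.exp_add]
  refine Real.exp_le_exp.2 (le_of_eq ?_)
  ring

/-- The Laplace integral of `lateralTerm`. -/
noncomputable def lateralValue (ε r : ℂ) (n : ℕ) : ℂ :=
  chi12 n * n * (2 * Complex.exp (-(r ^ 2 * singularPoint n)) *
    (expPrimitive r (Real.sqrt (singularPoint n)) +
      2 * (Real.sqrt Real.pi : ℂ) * r ^ 3 / 3 * ε))

/-- The `n`th integrand is dominated by a constant times `n⁻⁴ (1 + t)⁵ exp (-Re (r²) t / 2)`, which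
is summable in `n` and integrable in `t`, so sum and integral commute. -/
theorem hasLaplaceAlong_lateral {ε r : ℂ} {γ : ℝ → ℂ} (hε : IsLateral ε) (hr : 0 < r.re)
    (hx : 0 < (r ^ 2).re) (hγ : IsLaplacePath singularSet γ)
    (hside : ∀ t, 0 ≤ t → (ε * γ t).re ≤ 0) :
    ∃ L : ℂ, HasLaplaceAlong borelG γ (r ^ 2) L ∧ HasSum (fun n =>
      3 * (Real.pi : ℂ) / (2 * (Real.sqrt 2 : ℂ)) * lateralValue ε r n) L := by
  set c : ℂ := 3 * (Real.pi : ℂ) / (2 * (Real.sqrt 2 : ℂ)) with hc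
  obtain ⟨δ₀, hδ₀, hN₀⟩ := hγ.avoids
  -- Capping `δ` at `1` ensures `δ ≤ R` for the radius `R = K (1 + t)` used at time `t`.
  obtain ⟨δ, hδ, hδ1, hN⟩ : ∃ δ : ℝ, 0 < δ ∧ δ ≤ 1 ∧
      ∀ t, 0 ≤ t → ∀ η ∈ singularSet, δ ≤ ‖γ t - η‖ :=
    ⟨min δ₀ 1, by positivity, min_le_right _ _, fun t ht η hη =>
      (min_le_left _ _).trans (hN₀ t ht η hη)⟩
  obtain ⟨K, hK1, hK⟩ := hγ.exists_norm_le
  obtain ⟨E, hE1, hE⟩ := hγ.exists_norm_exp_le hx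
  obtain ⟨D, hD⟩ := hγ.deriv_bounded
  have hD0 : 0 ≤ D := (norm_nonneg _).trans (hD 1 one_pos)
  set B : ℝ := E * (2 * K / δ) ^ 5 * D with hB
  have hB0 : 0 ≤ B := by positivity
  set w : ℝ → ℝ := fun t => (1 + t) ^ 5 * Real.exp (-((r ^ 2).re / 2 * t)) with hw
  have hwi : IntegrableOn w (Ioi 0) := integrableOn_pow_mul_exp_neg 5 (half_pos hx)
  set F : ℕ → ℝ → ℂ := fun n t => Complex.exp (-(r ^ 2 * γ t)) * lateralTerm ε n (γ t) * deriv γ t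
    with hF
  have hterm : ∀ n t, 0 < t →
      ‖lateralTerm ε n (γ t)‖ ≤ (2 * (K * (1 + t)) / δ) ^ 5 * (1 / (n : ℝ) ^ 4) := fun n t ht =>
    norm_lateralTerm_le hε hδ (by nlinarith) (hK t ht.le) (hN t ht.le) n
  have hFle : ∀ n t, 0 < t → ‖F n t‖ ≤ B * (1 / (n : ℝ) ^ 4) * w t := fun n t ht => by
    rw [hF]
    simp only [norm_mul]
    calc _ ≤ (E * Real.exp (-((r ^ 2).re / 2 * t))) *
          ((2 * (K * (1 + t)) / δ) ^ 5 * (1 / (n : ℝ) ^ 4)) * D := by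
          have := hE t ht.le
          have := hterm n t ht
          have := hD t ht
          gcongr
      _ = _ := by rw [hB, hw]; field_simp
  have hcγ : ContinuousOn γ (Ioi 0) := hγ.continuousOn.mono Ioi_subset_Ici_self
  have hme : AEStronglyMeasurable (fun t => Complex.exp (-(r ^ 2 * γ t)))
      (volume.restrict (Ioi 0)) := by
    have : ContinuousOn (fun t => Complex.exp (-(r ^ 2 * γ t))) (Ioi 0) := by fun_prop
    exact this.aestronglyMeasurable measurableSet_Ioi
  have hmd : AEStronglyMeasurable (deriv γ) (volume.restrict (Ioi 0)) :=
    (stronglyMeasurable_deriv γ).aestronglyMeasurable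
  have hne : ∀ n, chi12 n ≠ 0 → ∀ t, 0 ≤ t → γ t ≠ singularPoint n := fun n hn t ht h => by
    have := hN t ht _ (singularPoint_mem hn)
    rw [h, sub_self, norm_zero] at this
    linarith
  have hFm : ∀ n, AEStronglyMeasurable (F n) (volume.restrict (Ioi 0)) := fun n => by
    have h1 : ContinuousOn (fun t => lateralTerm ε n (γ t)) (Ioi 0) := fun t ht =>
      (differentiableAt_lateralTerm fun hn => hε.mul_mem_slitPlane (hside t (le_of_lt ht))
        (hne n hn t (le_of_lt ht))).continuousAt.comp_continuousWithinAt (hcγ t ht)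
    exact (hme.mul (h1.aestronglyMeasurable measurableSet_Ioi)).mul hmd
  have hFi : ∀ n, IntegrableOn (F n) (Ioi 0) := fun n =>
    (hwi.const_mul (B * (1 / (n : ℝ) ^ 4))).mono' (hFm n)
      ((ae_restrict_iff' measurableSet_Ioi).2 (.of_forall fun t ht => hFle n t ht))
  have hFs : Summable fun n => ∫ t in Ioi 0, ‖F n t‖ := by
    refine .of_nonneg_of_le (fun n => integral_nonneg fun t => norm_nonneg _) (fun n => ?_)
      (summable_lateral_bound (B * ∫ t in Ioi 0, w t))
    calc _ ≤ ∫ t in Ioi 0, B * (1 / (n : ℝ) ^ 4) * w t :=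
          setIntegral_mono_on (hFi n).norm (hwi.const_mul _) measurableSet_Ioi
            fun t ht => hFle n t ht
      _ = _ := by rw [integral_const_mul]; ring
  have hsum := (hasSum_integral_of_summable_integral_norm hFi hFs).mul_left c
  have hval : ∀ n, ∫ t in Ioi 0, F n t = lateralValue ε r n := fun n => by
    by_cases hn : chi12 n = 0
    · simp [hF, lateralValue, lateralTerm, hn]
    have hn0 := pos_of_chi12_ne_zero hn
    have hk : chi12 n * n ≠ 0 := mul_ne_zero hn (Nat.cast_ne_zero.2 hn0.ne')
    have hη : 0 < singularPoint n :=
      lt_of_lt_of_le (by positivity) (sq_le_singularPoint n)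
    have hFe : F n = fun t => chi12 n * n * (Complex.exp (-(r ^ 2 * γ t)) /
        lateralSqrt ε (singularPoint n - γ t) ^ 5 * deriv γ t) := by
      ext t
      rw [hF]
      simp only [lateralTerm]
      ring
    have hi := (hFi n).const_mul (chi12 n * n)⁻¹
    simp only [hFe, inv_mul_cancel_left₀ hk] at hi
    rw [hFe, integral_const_mul, integral_lateral hε hr hx hη hγ hside (hne n hn) hi, lateralValue]
  simp only [hval] at hsum
  have hG : ∀ t, Complex.exp (-(r ^ 2 * γ t)) * lateralG ε (γ t) * deriv γ t =
      c * ∑' n, F n t := fun t => by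
    rw [hF]
    simp only [tsum_mul_right, tsum_mul_left, lateralG]
    ring
  refine ⟨_, ⟨fun t => lateralG ε (γ t), isContinuationAlong_lateralG hε hγ hside, ?_, ?_⟩, hsum⟩
  · simp only [hG]
    refine Integrable.const_mul ?_ c
    have hi : Integrable (fun t => (∑' n : ℕ, B * (1 / (n : ℝ) ^ 4)) * w t)
        (volume.restrict (Ioi 0)) := hwi.const_mul _
    refine hi.mono' ?_ ((ae_restrict_iff' measurableSet_Ioi).2 (.of_forall fun t ht => ?_))
    · have hGm : ContinuousOn (fun t => lateralG ε (γ t)) (Ioi 0) := fun t ht =>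
        (analyticAt_lateralG hε (hside t (le_of_lt ht)) hδ
          (hN t (le_of_lt ht))).continuousAt.comp_continuousWithinAt (hcγ t ht)
      have h1 := ((hme.mul (hGm.aestronglyMeasurable measurableSet_Ioi)).mul hmd).const_mul c⁻¹
      -- Measurability of `∑' n, F n t` is read off from the continuous function `lateralG ε ∘ γ`,
      -- after dividing by `c`.
      have hc0 : c ≠ 0 := by
        have h2 : (Real.sqrt 2 : ℂ) ≠ 0 := by
          exact_mod_cast (by positivity : Real.sqrt 2 ≠ 0)
        have hpi : (Real.pi : ℂ) ≠ 0 := by exact_mod_cast Real.pi_ne_zero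
        rw [hc]
        exact div_ne_zero (by simp [hpi]) (by simp [h2])
      refine h1.congr (.of_forall fun t => ?_)
      simp only [Pi.mul_apply, hG, inv_mul_cancel_left₀ hc0]
    · rw [← tsum_mul_right]
      exact tsum_of_norm_bounded ((summable_lateral_bound B).mul_right (w t)).hasSum
        fun n => hFle n t ht
  · simp only [hG]
    rw [integral_const_mul]

/-- The algebra behind `lateralValue_average`, with `a = √2`, `b = √3`, `P = √π`, `y = √(x/6)` and
`A = e^{-z²} erfi z` at `z = nπy`. Then `n P² / (a b) = √η` and `a b y = r`. -/
theorem lateralValue_average_aux {a b P n y A : ℂ} (ha : a ^ 2 = 2) (hb : b ^ 2 = 3) (hP : P ≠ 0)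
    (hn : n ≠ 0) :
    3 * P ^ 2 / (2 * a) * (n * (2 * (-1 / (3 * (n * P ^ 2 / (a * b)) ^ 3) -
      2 * (a * b * y) ^ 2 / 3 * (1 / (n * P ^ 2 / (a * b))) + 2 * P * (a * b * y) ^ 3 / 3 * A))) =
    12 * b / P ^ 3 * (1 / n ^ 2 * ((n * P ^ 2 * y) ^ 3 * A - (n * P ^ 2 * y) ^ 2 / P)) -
      6 * b / P ^ 4 * (1 / n ^ 2) := by
  have ha0 : a ≠ 0 := by rintro rfl; norm_num at ha
  have hb0 : b ≠ 0 := by rintro rfl; norm_num at hb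
  trans a ^ 2 * (b ^ 2 * b) * (-1 / (n ^ 2 * P ^ 4) - 2 * y ^ 2 + 2 * P ^ 3 * n * y ^ 3 * A)
  · field_simp
  · rw [ha, hb]
    field_simp
    ring

theorem lateralValue_average {x r : ℂ} (hr : r = Real.sqrt 6 * (x / 6) ^ (1 / 2 : ℂ)) (n : ℕ) :
    (3 * (Real.pi : ℂ) / (2 * (Real.sqrt 2 : ℂ)) * lateralValue (-Complex.I) r n +
      3 * (Real.pi : ℂ) / (2 * (Real.sqrt 2 : ℂ)) * lateralValue Complex.I r n) / 2 =
    12 * (Real.sqrt 3 : ℂ) / ((Real.pi ^ (3 / 2 : ℝ) : ℝ) : ℂ) * lapTerm n x -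
      6 * (Real.sqrt 3 : ℂ) / (Real.pi : ℂ) ^ 2 * (chi12 n / (n : ℂ) ^ 2) := by
  rcases Nat.eq_zero_or_pos n with rfl | hn
  · simp [lateralValue, lapTerm]
  set P : ℂ := (Real.sqrt Real.pi : ℂ) with hPdef
  have hP : P ≠ 0 := sqrt_pi_ne_zero
  have hn0 : (n : ℂ) ≠ 0 := Nat.cast_ne_zero.2 hn.ne'
  have hpi : (Real.pi : ℂ) = P ^ 2 := by
    rw [hPdef, ← Complex.ofReal_pow, Real.sq_sqrt Real.pi_pos.le]
  have hpi3 : ((Real.pi ^ (3 / 2 : ℝ) : ℝ) : ℂ) = P ^ 3 := by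
    rw [hPdef, ← Complex.ofReal_pow]
    congr 1
    rw [Real.sqrt_eq_rpow, ← Real.rpow_natCast, ← Real.rpow_mul Real.pi_pos.le]
    norm_num
  have h2 : (Real.sqrt 2 : ℂ) ^ 2 = 2 := by
    rw [← Complex.ofReal_pow, Real.sq_sqrt (by norm_num)]
    norm_num
  have h3 : (Real.sqrt 3 : ℂ) ^ 2 = 3 := by
    rw [← Complex.ofReal_pow, Real.sq_sqrt (by norm_num)]
    norm_num
  have h6 : (Real.sqrt 6 : ℂ) = (Real.sqrt 2 : ℂ) * (Real.sqrt 3 : ℂ) := by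
    rw [← Complex.ofReal_mul, ← Real.sqrt_mul (by norm_num)]
    norm_num
  have h60 : (Real.sqrt 6 : ℂ) ≠ 0 := by
    exact_mod_cast (by positivity : Real.sqrt 6 ≠ 0)
  have hη : (Real.sqrt (singularPoint n) : ℂ) =
      n * P ^ 2 / ((Real.sqrt 2 : ℂ) * (Real.sqrt 3 : ℂ)) := by
    rw [← h6, ← hpi, singularPoint, ← mul_pow, Real.sqrt_div (by positivity),
      Real.sqrt_sq (by positivity)]
    push_cast
    rfl
  set s : ℂ := (Real.sqrt (singularPoint n) : ℂ) with hs
  have hs2 : (singularPoint n : ℂ) = s ^ 2 := by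
    rw [hs, ← Complex.ofReal_pow, Real.sq_sqrt ((sq_nonneg _).trans (sq_le_singularPoint n))]
  set y : ℂ := (x / 6) ^ (1 / 2 : ℂ) with hy
  have hz : s * r = n * P ^ 2 * y := by
    rw [hη, hr, ← h6]
    field_simp
  have hr' : r = (Real.sqrt 2 : ℂ) * (Real.sqrt 3 : ℂ) * y := by rw [hr, h6]
  have hexp : Complex.exp (-(r ^ 2 * s ^ 2)) * Complex.exp (s ^ 2 * r ^ 2) = 1 := by
    rw [← Complex.exp_add, mul_comm, neg_add_cancel, Complex.exp_zero]
  have hexp2 : Complex.exp (-(r ^ 2 * s ^ 2)) = Complex.exp (-(n * P ^ 2 * y) ^ 2) := by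
    rw [← hz]
    congr 1
    ring
  have h := lateralValue_average_aux (y := y)
    (A := Complex.exp (-(n * P ^ 2 * y) ^ 2) * erfi (n * P ^ 2 * y)) h2 h3 hP hn0
  rw [← hη, ← hr', ← hz] at h
  rw [← hz] at hexp2
  unfold lateralValue lapTerm modErfi expPrimitive
  rw [hs2, hpi, hpi3, ← hz, ← hs, ← hPdef, ← hexp2]
  rw [← hexp2] at h
  have e1 : Complex.exp (-(r ^ 2 * s ^ 2)) * (-Complex.exp (s ^ 2 * r ^ 2) / (3 * s ^ 3) -
      2 * r ^ 2 / 3 * (Complex.exp (s ^ 2 * r ^ 2) / s) + 2 * P * r ^ 3 / 3 * erfi (s * r)) =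
      -1 / (3 * s ^ 3) - 2 * r ^ 2 / 3 * (1 / s) +
        2 * P * r ^ 3 / 3 * (Complex.exp (-(r ^ 2 * s ^ 2)) * erfi (s * r)) := by
    linear_combination (-1 / (3 * s ^ 3) - 2 * r ^ 2 / 3 * (1 / s)) * hexp
  rw [← e1] at h
  linear_combination chi12 n * h

theorem hasMedianLaplace_borelG {x : ℂ} (hx : 0 < x.re) :
    HasMedianLaplace singularSet borelG x
      (12 * (Real.sqrt 3 : ℂ) / ((Real.pi ^ (3 / 2 : ℝ) : ℝ) : ℂ) * ∑' n : ℕ, lapTerm n x - 1) := by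
  intro γr γl hγr hγl
  -- This form of `√x` makes `√η · r` equal to `nπ√(x/6)` without a multiplicativity argument for
  -- complex powers.
  obtain ⟨r, hr⟩ : ∃ r : ℂ, r = Real.sqrt 6 * (x / 6) ^ (1 / 2 : ℂ) := ⟨_, rfl⟩
  have hr2 : r ^ 2 = x := by
    rw [hr, mul_pow, cpow_half_sq, ← Complex.ofReal_pow, Real.sq_sqrt (by norm_num)]
    push_cast
    ring
  have hr0 : 0 < r.re := by
    rw [hr, Complex.re_ofReal_mul]
    refine mul_pos (by positivity) (cpow_half_re_pos (Or.inl ?_))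
    rw [Complex.div_ofNat_re]
    positivity
  have hx' : 0 < (r ^ 2).re := by rwa [hr2]
  obtain ⟨Lr, hLr, hsr⟩ := hasLaplaceAlong_lateral (ε := -Complex.I) (Or.inr rfl) hr0 hx' hγr.1
    fun t ht => by simpa using hγr.2 t ht
  obtain ⟨Ll, hLl, hsl⟩ := hasLaplaceAlong_lateral (ε := Complex.I) (Or.inl rfl) hr0 hx' hγl.1
    fun t ht => by simpa using hγl.2 t ht
  rw [hr2] at hLr hLl
  refine ⟨Lr, Ll, hLr, hLl, ?_⟩
  have h1 := (hsr.add hsl).div_const 2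
  simp only [lateralValue_average hr] at h1
  have h2 := ((summable_lapTerm hx).hasSum.mul_left
    (12 * (Real.sqrt 3 : ℂ) / ((Real.pi ^ (3 / 2 : ℝ) : ℝ) : ℂ))).sub
    (hasSum_chi12_div_sq.mul_left (6 * (Real.sqrt 3 : ℂ) / (Real.pi : ℂ) ^ 2))
  have h3 : (Real.sqrt 3 : ℂ) ≠ 0 := by exact_mod_cast (by positivity : Real.sqrt 3 ≠ 0)
  have hpi : (Real.pi : ℂ) ≠ 0 := by exact_mod_cast Real.pi_ne_zero
  have e : 6 * (Real.sqrt 3 : ℂ) / (Real.pi : ℂ) ^ 2 *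
      ((Real.pi ^ 2 / (6 * Real.sqrt 3) : ℝ) : ℂ) = 1 := by
    push_cast
    field_simp
  rw [e] at h2
  exact h1.unique h2

theorem mainTheorem3 :
    (∀ x : ℂ, 0 < x.re →
      Summable (fun n : ℕ => lapTerm n x) ∧
      HasMedianLaplace singularSet borelG x
        (12 * (Real.sqrt 3 : ℂ) / ((Real.pi ^ (3 / 2 : ℝ) : ℝ) : ℂ) * ∑' n : ℕ, lapTerm n x - 1)) ∧
    TendstoLocallyUniformlyOn (fun (M : ℕ) (x : ℂ) => ∑ n ∈ Finset.Icc 1 M, lapTerm n x)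
      (fun x => ∑' n : ℕ, lapTerm n x) atTop {x : ℂ | 0 < x.re} ∧
    ∀ θ : ℝ, θ < Real.pi / 2 →
      TendstoUniformlyOn (fun (M : ℕ) (x : ℂ) => ∑ n ∈ Finset.Icc 1 M, lapTerm n x)
        (fun x => ∑' n : ℕ, lapTerm n x) atTop {x : ℂ | 0 < x.re ∧ |x.arg| ≤ θ} :=
  ⟨fun _ hx => ⟨summable_lapTerm hx, hasMedianLaplace_borelG hx⟩,
    tendstoLocallyUniformlyOn_lapTerm, fun _ hθ => tendstoUniformlyOn_sector_lapTerm hθ⟩
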